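/- For positive integers $k, m$ let $S_k(m) = 1^k + 2^k + \cdots + (m-1)^k$ and \[ g_k(m) = \frac{\gcd(S_k(m), S_k(m+1))}{m}, \] and let $B_k$ denote the $k$-th Bernoulli number, defined by $\frac{z}{e^z-1} = \sum_{n \ge 0} B_n \frac{z^n}{n!}$. For an even positive integer $k$ consider the property \[ (\ast_k)\qquad \min_{m \ge 2} g_k(m) \cdot \max_{m \ge 2} g_k(m) = |B_k|, \] where it is part of the property that the minimum and the maximum over all integers $m \ge 2$ exist. \textbf{Proposition.} (1) Let $k$ be a positive integer and, if $k$ is even, suppose that $(\ast_k)$ holds. Then a positive integer $m$ satisfies $S_k(m) = m^k$ if and only if $(k,m) = (1,3)$; in particular, there is no solution $m$ if $k \ge 2$. (2) Consequently, if $(\ast_k)$ holds for every even positive integer $k$, then the Erdős–Moser conjecture holds: $(k,m) = (1,3)$ is the only solution of $S_k(m) = m^k$ in positive integers $k, m$. -/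

import Mathlib

namespace ErdosMoser

/-- The power sum `S_k(m) = 1^k + 2^k + ⋯ + (m-1)^k`. -/
def S (k m : ℕ) : ℕ := ∑ j ∈ Finset.Ico 1 m, j ^ k

/-- The rational number `g_k(m) = gcd(S_k(m), S_k(m+1)) / m`. -/
def g (k m : ℕ) : ℚ := (Nat.gcd (S k m) (S k (m + 1)) : ℚ) / (m : ℚ)

/-- `g_k` attains a minimum `a` and a maximum `b` on the integers `m ≥ 2`, and
`a * b = |B_k|`. -/
def MinMulMaxEqBernoulli (k : ℕ) : Prop :=
  ∃ a b : ℚ, IsLeast (g k '' Set.Ici 2) a ∧ IsGreatest (g k '' Set.Ici 2) b ∧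
    a * b = |bernoulli k|

/-- The product conjecture: the identity `min g_k * max g_k = |B_k|` holds for every positive
even `k`. -/
def GcdConjecture : Prop :=
  ∀ k : ℕ, 0 < k → Even k → MinMulMaxEqBernoulli k

/-- The Erdős–Moser conjecture: the only solution of `S_k(m) = m^k` in positive integers is
`(k, m) = (1, 3)`. -/
def ErdosMoserConjecture : Prop :=
  ∀ k m : ℕ, 0 < k → 0 < m → (S k m = m ^ k ↔ k = 1 ∧ m = 3)

end ErdosMoser

namespace ErdosMoser

/-! For odd `k`, a solution `m = n + 1` forces `n ∣ 2 * (n + 1) ^ k`, hence `n ∣ 2`, leaving three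
cases. For even `k`, a solution makes the gcd equal to `m ^ k`, so the maximum of `g k` is at least
`m ^ (k - 1)`, and `k < m`. The minimum is at least `1 / (2 * (2 ^ k - 1))` since `n ∣ 2 * (2 ^ k -
1) * S k n`. Their product then exceeds the bound on `|bernoulli k|` given by Euler's formula for
`ζ(k)`, a contradiction. -/

theorem S_eq_sum_range {k : ℕ} (hk : 0 < k) (m : ℕ) : S k m = ∑ j ∈ Finset.range m, j ^ k := by
  rcases Nat.eq_zero_or_pos m with rfl | hm
  · simp [S]
  · rw [S, Finset.range_eq_Ico, Finset.sum_eq_sum_Ico_succ_bot hm]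
    simp [hk.ne']

theorem S_succ {k m : ℕ} (hk : 0 < k) : S k (m + 1) = S k m + m ^ k := by
  rw [S_eq_sum_range hk, S_eq_sum_range hk, Finset.sum_range_succ]

/-- For odd `k`, the number `m` divides `2 * S_k(m + 1)`. -/
theorem dvd_two_mul_S_succ {k : ℕ} (hk : Odd k) (m : ℕ) : m ∣ 2 * S k (m + 1) := by
  have h : 2 * S k (m + 1) = ∑ j ∈ Finset.range (m + 1), (j ^ k + (m - j) ^ k) := by
    rw [S_eq_sum_range hk.pos, two_mul, Finset.sum_add_distrib,
      ← Finset.sum_range_reflect (fun j => j ^ k) (m + 1)]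
    simp only [Nat.add_sub_cancel]
  rw [h]
  refine Finset.dvd_sum fun j hj => ?_
  rw [Finset.mem_range] at hj
  have := Odd.nat_add_dvd_pow_add_pow j (m - j) hk
  rwa [show j + (m - j) = m by omega] at this

theorem S_eq_pow_iff_of_odd {k m : ℕ} (hk : Odd k) (hm : 0 < m) :
    S k m = m ^ k ↔ k = 1 ∧ m = 3 := by
  constructor
  · intro h
    obtain ⟨n, rfl⟩ : ∃ n, m = n + 1 := ⟨m - 1, by omega⟩
    have hdvd : n ∣ 2 := by
      have h1 := dvd_two_mul_S_succ hk n
      rw [h] at h1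
      have hco : Nat.Coprime n ((n + 1) ^ k) :=
        ((Nat.coprime_self_add_right).2 (Nat.coprime_one_right n)).pow_right k
      exact hco.dvd_of_dvd_mul_right h1
    have hn : n ≤ 2 := Nat.le_of_dvd two_pos hdvd
    interval_cases n
    · simp [S] at h
    · have : 1 < 2 ^ k := Nat.one_lt_two_pow hk.pos.ne'
      simp [S] at h
      omega
    · refine ⟨?_, rfl⟩
      by_contra hk1
      obtain ⟨l, rfl⟩ : ∃ l, k = l + 2 := ⟨k - 2, by have := hk.pos; omega⟩
      have h2 : S (l + 2) 3 = 1 + 2 ^ (l + 2) := by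
        simp [S, Finset.sum_Ico_succ_top]
      have h3 : 2 ^ l ≤ 3 ^ l := Nat.pow_le_pow_left (by norm_num) l
      have h4 : 0 < 2 ^ l := by positivity
      simp only [h2, Nat.reduceAdd, pow_add] at h
      omega
  · rintro ⟨rfl, rfl⟩
    decide

theorem pow_succ_add_mul_pow_le (j k : ℕ) :
    j ^ (k + 1) + (k + 1) * j ^ k ≤ (j + 1) ^ (k + 1) := by
  induction k with
  | zero => simp
  | succ k ih =>
    calc j ^ (k + 1 + 1) + (k + 1 + 1) * j ^ (k + 1)
        ≤ (j ^ (k + 1) + (k + 1) * j ^ k) * (j + 1) := by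
          have : 0 ≤ (k + 1) * j ^ k := Nat.zero_le _
          ring_nf at this ⊢
          omega
      _ ≤ (j + 1) ^ (k + 1) * (j + 1) := Nat.mul_le_mul_right _ ih
      _ = (j + 1) ^ (k + 1 + 1) := (pow_succ _ _).symm

/-- Telescoping of the preceding inequality, a discrete form of `S k m ≤ ∫₀^m x ^ k`. -/
theorem succ_mul_S_le {k : ℕ} (hk : 0 < k) (m : ℕ) : (k + 1) * S k m ≤ m ^ (k + 1) := by
  induction m with
  | zero => simp [S]
  | succ m ih =>
    rw [S_succ hk, mul_add]
    exact (Nat.add_le_add_right ih _).trans (pow_succ_add_mul_pow_le m k)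

theorem lt_of_S_eq_pow {k m : ℕ} (hk : 0 < k) (hm : 0 < m) (h : S k m = m ^ k) : k < m := by
  have h1 := succ_mul_S_le hk m
  rw [h, pow_succ, mul_comm] at h1
  exact Nat.le_of_mul_le_mul_left h1 (by positivity)

/-- Multiplication by the unit 2 permutes `ZMod n`, so the power sum is fixed by the factor `2 ^ k`.
-/
theorem dvd_pow_sub_one_mul_sum_range_of_odd {n : ℕ} (hn : Odd n) (k : ℕ) :
    (n : ℤ) ∣ (2 ^ k - 1) * ∑ j ∈ Finset.range n, (j : ℤ) ^ k := by
  have : NeZero n := ⟨hn.pos.ne'⟩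
  have hsum : ((∑ j ∈ Finset.range n, (j : ℤ) ^ k : ℤ) : ZMod n) = ∑ x : ZMod n, x ^ k := by
    push_cast
    refine Finset.sum_bij (fun j _ => (j : ZMod n)) (fun _ _ => Finset.mem_univ _) ?_ ?_ ?_
    · intro a ha b hb hab
      rw [Finset.mem_range] at ha hb
      have := congrArg ZMod.val hab
      rwa [ZMod.val_cast_of_lt ha, ZMod.val_cast_of_lt hb] at this
    · intro x _
      exact ⟨x.val, Finset.mem_range.2 x.val_lt, ZMod.natCast_zmod_val x⟩
    · intros; rfl
  have h2 : IsUnit (2 : ZMod n) := by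
    have := (ZMod.isUnit_iff_coprime 2 n).2 (Nat.coprime_two_left.2 hn)
    exact_mod_cast this
  obtain ⟨u, hu⟩ := h2
  have hperm : ∑ x : ZMod n, (2 * x) ^ k = ∑ x : ZMod n, x ^ k := by
    rw [← hu]
    exact Equiv.sum_comp (Units.mulLeft u) (fun x => x ^ k)
  rw [← ZMod.intCast_zmod_eq_zero_iff_dvd, Int.cast_mul, hsum]
  simp only [mul_pow, ← Finset.mul_sum] at hperm
  push_cast
  rw [sub_mul, hperm, one_mul, sub_self]

theorem dvd_two_mul_pow_sub_one_mul_sum_range (k n : ℕ) (hn : 0 < n) :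
    (n : ℤ) ∣ 2 * (2 ^ k - 1) * ∑ j ∈ Finset.range n, (j : ℤ) ^ k := by
  induction n using Nat.strong_induction_on with
  | _ n ih =>
    rcases Nat.even_or_odd' n with ⟨l, rfl | hl⟩
    · obtain ⟨c, hc⟩ := ih l (by omega) (by omega)
      -- For `n = 2 * l` the two halves of the sum agree mod `l`; the extra factor 2 absorbs the
      -- error `l * d`.
      obtain ⟨d, hd⟩ : (l : ℤ) ∣ ∑ j ∈ Finset.range l, (((l + j : ℕ) : ℤ) ^ k - (j : ℤ) ^ k) := by
        refine Finset.dvd_sum fun j _ => ?_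
        have := sub_dvd_pow_sub_pow ((l + j : ℕ) : ℤ) (j : ℤ) k
        simpa using this
      rw [Finset.sum_sub_distrib, sub_eq_iff_eq_add] at hd
      rw [two_mul l, Finset.sum_range_add, hd]
      exact ⟨c + (2 ^ k - 1) * d, by push_cast; linear_combination 2 * hc⟩
    · have := dvd_pow_sub_one_mul_sum_range_of_odd (n := n) ⟨l, hl⟩ k
      rw [mul_assoc]
      exact this.mul_left 2

theorem le_two_mul_pow_sub_one_mul_gcd {k n : ℕ} (hk : 0 < k) (hn : 2 ≤ n) :
    n ≤ 2 * (2 ^ k - 1) * Nat.gcd (S k n) (S k (n + 1)) := by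
  have h1 : n ∣ 2 * (2 ^ k - 1) * S k n := by
    have := dvd_two_mul_pow_sub_one_mul_sum_range k n (by omega)
    rw [S_eq_sum_range hk, ← Int.natCast_dvd_natCast]
    push_cast [Nat.one_le_two_pow]
    exact this
  have h2 : n ∣ 2 * (2 ^ k - 1) * S k (n + 1) := by
    rw [S_succ hk, mul_add]
    exact h1.add ((dvd_pow_self n hk.ne').mul_left _)
  have h3 := Nat.dvd_gcd h1 h2
  rw [Nat.gcd_mul_left] at h3
  refine Nat.le_of_dvd ?_ h3
  have hpos : 0 < S k (n + 1) := by
    rw [S_succ hk]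
    positivity
  have : 1 < 2 ^ k := Nat.one_lt_two_pow hk.ne'
  exact Nat.mul_pos (by omega) (Nat.gcd_pos_of_pos_right _ hpos)

theorem one_le_mul_g {k n : ℕ} (hk : 0 < k) (hn : 2 ≤ n) :
    (1 : ℚ) ≤ 2 * (2 ^ k - 1) * g k n := by
  have h := le_two_mul_pow_sub_one_mul_gcd hk hn
  have h' : (n : ℚ) ≤ 2 * (2 ^ k - 1) * (Nat.gcd (S k n) (S k (n + 1)) : ℚ) := by
    have : ((n : ℕ) : ℚ) ≤ ((2 * (2 ^ k - 1) * Nat.gcd (S k n) (S k (n + 1)) : ℕ) : ℚ) :=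
      Nat.cast_le.2 h
    push_cast [Nat.one_le_two_pow] at this
    exact this
  have hn0 : (0 : ℚ) < n := by exact_mod_cast (by omega : 0 < n)
  rw [g, ← mul_div_assoc, le_div_iff₀ hn0, one_mul]
  exact h'

theorem g_eq_pow_of_S_eq_pow {k m : ℕ} (hk : 0 < k) (hm : 0 < m) (h : S k m = m ^ k) :
    g k m = (m : ℚ) ^ (k - 1) := by
  have hm0 : (m : ℚ) ≠ 0 := by exact_mod_cast hm.ne'
  have hg : Nat.gcd (S k m) (S k (m + 1)) = m ^ k := by
    rw [S_succ hk, h]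
    simp
  rw [g, hg, div_eq_iff hm0, ← pow_succ, Nat.sub_add_cancel hk]
  push_cast
  rfl

/-- Euler's formula combined with `ζ(2r) ≤ ζ(2) = π² / 6 ≤ 2`. -/
theorem abs_bernoulli_two_mul_le {r : ℕ} (hr : r ≠ 0) :
    |(bernoulli (2 * r) : ℝ)| ≤ 4 * (2 * r).factorial / (2 * Real.pi) ^ (2 * r) := by
  have hz := hasSum_zeta_nat hr
  have hle : ∑' n : ℕ, 1 / (n : ℝ) ^ (2 * r) ≤ 2 := by
    have h2 := hasSum_zeta_two
    have : ∑' n : ℕ, 1 / (n : ℝ) ^ (2 * r) ≤ Real.pi ^ 2 / 6 := by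
      refine hasSum_le (fun n => ?_) hz.summable.hasSum h2
      rcases Nat.eq_zero_or_pos n with rfl | hn
      · simp [hr]
      · have h1 : (1 : ℝ) ≤ n := by exact_mod_cast hn
        exact one_div_le_one_div_of_le (by positivity) (pow_le_pow_right₀ h1 (by omega))
    nlinarith [Real.pi_lt_d2, Real.pi_pos]
  rw [hz.tsum_eq] at hle
  have hnn := hz.nonneg (fun n => by positivity)
  have hfac : (0 : ℝ) < (2 * r).factorial := by exact_mod_cast Nat.factorial_pos _
  have habs : |(bernoulli (2 * r) : ℝ)| * (2 ^ (2 * r - 1) * Real.pi ^ (2 * r) /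
      (2 * r).factorial) ≤ 2 := by
    rw [← abs_of_nonneg hnn] at hle
    refine le_trans (le_of_eq ?_) hle
    simp only [abs_mul, abs_div, abs_pow, abs_neg, abs_one, one_pow, one_mul, abs_two,
      abs_of_pos Real.pi_pos, abs_of_pos hfac]
    ring
  have hpow : (2 : ℝ) ^ (2 * r) = 2 ^ (2 * r - 1) * 2 := by
    rw [← pow_succ]
    congr 1
    omega
  rw [le_div_iff₀ (by positivity), mul_pow, hpow]
  rw [← mul_div_assoc, div_le_iff₀ hfac] at habs
  linarith

theorem factorial_le_pow_pred {k : ℕ} (hk : 0 < k) : k.factorial ≤ k ^ (k - 1) := by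
  obtain ⟨l, rfl⟩ : ∃ l, k = l + 1 := ⟨k - 1, by omega⟩
  rw [Nat.add_sub_cancel]
  induction l with
  | zero => simp
  | succ l ih =>
    rw [Nat.factorial_succ, mul_comm, pow_succ]
    exact Nat.mul_le_mul_right _
      ((ih l.succ_pos).trans (Nat.pow_le_pow_left (Nat.le_succ _) l))

theorem mul_abs_bernoulli_lt {k : ℕ} (hk : 0 < k) (he : Even k) :
    2 * (2 ^ k - 1) * |bernoulli k| < (k : ℚ) ^ (k - 1) := by
  obtain ⟨r, hr⟩ := he.two_dvd
  have hr0 : r ≠ 0 := by omega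
  have hB := abs_bernoulli_two_mul_le hr0
  rw [← hr, mul_pow, le_div_iff₀ (by positivity)] at hB
  have hfac : (k.factorial : ℝ) ≤ (k : ℝ) ^ (k - 1) := by
    exact_mod_cast factorial_le_pow_pred hk
  -- Any bound above 8 gives strictness: the left side is at most `8 * k! / π ^ k`.
  have hpi : (9 : ℝ) ≤ Real.pi ^ k := by
    calc (9 : ℝ) = 3 ^ 2 := by norm_num
      _ ≤ Real.pi ^ 2 := pow_le_pow_left₀ (by norm_num) Real.pi_gt_three.le 2
      _ ≤ Real.pi ^ k := pow_le_pow_right₀ (by linarith [Real.pi_gt_three]) (by omega)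
  have hfpos : (0 : ℝ) < k.factorial := by exact_mod_cast Nat.factorial_pos _
  have h2 : 2 ^ k * |(bernoulli k : ℝ)| * 9 ≤ 4 * k.factorial := by
    calc 2 ^ k * |(bernoulli k : ℝ)| * 9 ≤ 2 ^ k * |(bernoulli k : ℝ)| * Real.pi ^ k := by gcongr
      _ ≤ 4 * k.factorial := by linarith
  have h3 : 2 * (2 ^ k - 1) * |(bernoulli k : ℝ)| < (k : ℝ) ^ (k - 1) := by
    nlinarith [abs_nonneg (bernoulli k : ℝ)]
  exact_mod_cast h3

theorem S_ne_pow_of_minMulMaxEqBernoulli {k m : ℕ} (hk : 0 < k) (he : Even k)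
    (hB : MinMulMaxEqBernoulli k) (hm : 0 < m) : S k m ≠ m ^ k := by
  intro h
  obtain ⟨a, b, ⟨⟨n, hn, rfl⟩, -⟩, ⟨-, hb⟩, hab⟩ := hB
  have hkm := lt_of_S_eq_pow hk hm h
  have hmb : (m : ℚ) ^ (k - 1) ≤ b := by
    rw [← g_eq_pow_of_S_eq_pow hk hm h]
    exact hb ⟨m, Set.mem_Ici.2 (by omega), rfl⟩
  have hkm' : (k : ℚ) ^ (k - 1) ≤ (m : ℚ) ^ (k - 1) := by gcongr
  have hg := one_le_mul_g hk hn
  have hlt := mul_abs_bernoulli_lt hk he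
  have hb0 : 0 ≤ b := le_trans (by positivity) hmb
  rw [← hab, ← mul_assoc] at hlt
  have := le_mul_of_one_le_left hb0 hg
  linarith

theorem S_eq_pow_iff {k : ℕ} (hk : 0 < k) (hB : Even k → MinMulMaxEqBernoulli k) {m : ℕ}
    (hm : 0 < m) : S k m = m ^ k ↔ k = 1 ∧ m = 3 := by
  rcases Nat.even_or_odd k with he | ho
  · refine iff_of_false (S_ne_pow_of_minMulMaxEqBernoulli hk he (hB he) hm) ?_
    rintro ⟨rfl, -⟩
    exact Nat.not_even_one he
  · exact S_eq_pow_iff_of_odd ho hm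

end ErdosMoser

theorem mainTheorem2 :
    (∀ k : ℕ, 0 < k → (Even k → ErdosMoser.MinMulMaxEqBernoulli k) →
      ∀ m : ℕ, 0 < m → (ErdosMoser.S k m = m ^ k ↔ k = 1 ∧ m = 3)) ∧
    (ErdosMoser.GcdConjecture → ErdosMoser.ErdosMoserConjecture) :=
  ⟨fun _ hk hB _ hm => ErdosMoser.S_eq_pow_iff hk hB hm,
    fun h k _ hk hm => ErdosMoser.S_eq_pow_iff hk (h k hk) hm⟩
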